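/- Let $d\ge 2$, let $\mathcal H_A,\mathcal H_B$ be complex Hilbert spaces of dimension $d$ with orthonormal bases $(|i\rangle)_{i\in[d]}$, $[d]=\{1,\dots,d\}$, and let $\mathcal H=\mathcal H_A\otimes\mathcal H_B$. For $|\psi\rangle\in\mathcal H$ put $\rho=\operatorname{Tr}_B|\psi\rangle\langle\psi|$ and $S_L(|\psi\rangle)=\frac{d}{d-1}\bigl(1-\operatorname{Tr}\rho^2\bigr)$, and define the entangling power of a unitary $U$ on $\mathcal H$ by $$\epsilon(U)=\int\!\!\int S_L\bigl(U|\psi_1\rangle|\psi_2\rangle\bigr)\,d\psi_2\,d\psi_1,$$ where $\psi_1,\psi_2$ run over the unit spheres of $\mathcal H_A,\mathcal H_B$ with their uniform probability measures. A permutation operator is a unitary $P$ on $\mathcal H$ of the form $P(|i\rangle|j\rangle)=|k_{ij}\rangle|l_{ij}\rangle$, where $(i,j)\mapsto(k_{ij},l_{ij})$ is a permutation of $[d]\times[d]$. A latin square of side $d$ is a $d\times d$ matrix over $[d]$ each of whose rows and columns is a permutation of $[d]$; latin squares $(k_{ij})$ and $(l_{ij})$ are orthogonal if $(i,j)\mapsto(k_{ij},l_{ij})$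 is a permutation of $[d]\times[d]$. Then: 1. $\epsilon(U)\le \frac{d}{d+1}$ for every unitary $U$ on $\mathcal H$; hence a unitary with $\epsilon(U)=\frac d{d+1}$ maximizes the entangling power over all unitaries on $\mathcal H$. 2. A permutation operator $P(|i\rangle|j\rangle)=|k_{ij}\rangle|l_{ij}\rangle$ satisfies $\epsilon(P)=\frac{d}{d+1}$ if and only if $(k_{ij})$ and $(l_{ij})$ are orthogonal latin squares. 3. The map $P\mapsto\bigl((k_{ij}),(l_{ij})\bigr)$ is a bijection from the set of permutation operators $P$ with $\epsilon(P)=\frac d{d+1}$ onto the set of ordered pairs of orthogonal latin squares of side $d$. Each unordered pair of orthogonal latin squares arises from exactly two such permutation operators. -/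

import Mathlib

open MeasureTheory
open scoped TensorProduct

/-- The normalized uniform (rotation invariant) probability measure on the unit sphere of a
finite-dimensional complex Hilbert space: the surface measure divided by its total mass. -/
noncomputable def uniformSphere (A : Type*) [NormedAddCommGroup A] [InnerProductSpace ℂ A]
    [FiniteDimensional ℂ A] [MeasurableSpace A] [BorelSpace A] :
    Measure (Metric.sphere (0 : A) 1) :=
  letI : ProperSpace A := FiniteDimensional.proper_rclike ℂ A
  letI σ : Measure (Metric.sphere (0 : A) 1) := (Measure.addHaar : Measure A).toSphere
  (σ Set.univ)⁻¹ • σ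

/-- The partial trace over the second factor: the linear map `End (A ⊗ B) → End A` with
`S ⊗ T ↦ (Tr T) • S`. -/
noncomputable def partialTraceRight (A B : Type*)
    [NormedAddCommGroup A] [InnerProductSpace ℂ A] [FiniteDimensional ℂ A]
    [NormedAddCommGroup B] [InnerProductSpace ℂ B] [FiniteDimensional ℂ B] :
    (A ⊗[ℂ] B →ₗ[ℂ] A ⊗[ℂ] B) →ₗ[ℂ] (A →ₗ[ℂ] A) :=
  (TensorProduct.rid ℂ (A →ₗ[ℂ] A)).toLinearMap ∘ₗ
    (LinearMap.trace ℂ B).lTensor (A →ₗ[ℂ] A) ∘ₗ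
    (homTensorHomEquiv ℂ A B A B).symm.toLinearMap

/-- The reduced operator `ρ = Tr_B |ψ⟩⟨ψ|`. -/
noncomputable def reducedState {A B : Type*}
    [NormedAddCommGroup A] [InnerProductSpace ℂ A] [FiniteDimensional ℂ A]
    [NormedAddCommGroup B] [InnerProductSpace ℂ B] [FiniteDimensional ℂ B]
    (ψ : A ⊗[ℂ] B) : A →ₗ[ℂ] A :=
  partialTraceRight A B (InnerProductSpace.rankOne ℂ ψ ψ).toLinearMap

/-- The linear entropy `S_L(ψ) = d / (d - 1) * (1 - Tr ρ²)`, with `d = dim A` and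
`ρ = Tr_B |ψ⟩⟨ψ|` (a self-adjoint operator, so that `Tr ρ²` is real). -/
noncomputable def linearEntropy {A B : Type*}
    [NormedAddCommGroup A] [InnerProductSpace ℂ A] [FiniteDimensional ℂ A]
    [NormedAddCommGroup B] [InnerProductSpace ℂ B] [FiniteDimensional ℂ B]
    (ψ : A ⊗[ℂ] B) : ℝ :=
  (Module.finrank ℂ A : ℝ) / ((Module.finrank ℂ A : ℝ) - 1) *
    (1 - (LinearMap.trace ℂ A (reducedState ψ ∘ₗ reducedState ψ)).re)

/-- The entangling power of a unitary `U` on `A ⊗ B`: the mean linear entropy of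
`U (ψ₁ ⊗ ψ₂)` over independent uniformly distributed unit vectors `ψ₁`, `ψ₂`. -/
noncomputable def entanglingPower {A B : Type*}
    [NormedAddCommGroup A] [InnerProductSpace ℂ A] [FiniteDimensional ℂ A]
    [MeasurableSpace A] [BorelSpace A]
    [NormedAddCommGroup B] [InnerProductSpace ℂ B] [FiniteDimensional ℂ B]
    [MeasurableSpace B] [BorelSpace B]
    (U : A ⊗[ℂ] B ≃ₗᵢ[ℂ] A ⊗[ℂ] B) : ℝ :=
  ∫ ψ₁ : Metric.sphere (0 : A) 1, ∫ ψ₂ : Metric.sphere (0 : B) 1,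
    linearEntropy (U ((ψ₁ : A) ⊗ₜ[ℂ] (ψ₂ : B))) ∂(uniformSphere B) ∂(uniformSphere A)

/-- `P (|i⟩|j⟩) = |K i j⟩|L i j⟩` for all `i`, `j`. As `P` is bijective, the map
`(i, j) ↦ (K i j, L i j)` is then a permutation. -/
def IsPermutationOperator {A B : Type*}
    [NormedAddCommGroup A] [InnerProductSpace ℂ A]
    [NormedAddCommGroup B] [InnerProductSpace ℂ B] {d : ℕ}
    (e : OrthonormalBasis (Fin d) ℂ A) (f : OrthonormalBasis (Fin d) ℂ B)
    (P : A ⊗[ℂ] B ≃ₗᵢ[ℂ] A ⊗[ℂ] B) (K L : Matrix (Fin d) (Fin d) (Fin d)) : Prop :=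
  ∀ i j, P (e i ⊗ₜ[ℂ] f j) = e (K i j) ⊗ₜ[ℂ] f (L i j)

/-- A latin square of side `d`: every row and every column is a permutation of the symbols. -/
def IsLatinSquare {d : ℕ} (K : Matrix (Fin d) (Fin d) (Fin d)) : Prop :=
  (∀ i, Function.Bijective fun j => K i j) ∧ (∀ j, Function.Bijective fun i => K i j)

/-- Two latin squares are orthogonal if `(i, j) ↦ (K i j, L i j)` is a permutation. -/
def IsOrthogonalLatinPair {d : ℕ} (K L : Matrix (Fin d) (Fin d) (Fin d)) : Prop :=
  IsLatinSquare K ∧ IsLatinSquare L ∧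
    Function.Bijective fun p : Fin d × Fin d => (K p.1 p.2, L p.1 p.2)

/-! Unitary invariance forces the fourth moments of a uniform unit vector to be E[x_i x̄_j x_k x̄_l]
= (δ_ij δ_kl + δ_il δ_kj) / (d(d+1)) (`sphereMoment_eq`). Expand Tr ρ² in product bases, with u k l
i j = ⟨kl|U|ij⟩, and average over both factors: four pairings of the indices appear. Two of them are
evaluated by unitarity of U and contribute d³ each. The other two are squared Hilbert–Schmidt norms
of d² × d² Gram matrices G of two reshufflings of U. Each G is Hermitian of trace d², so ‖G‖² = d² +
‖G − 1‖². This gives `entanglingPower_eq`: the entangling power is d/(d+1) minus a positive multiple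
of the two defects ‖G − 1‖². The bound follows, with equality exactly when both Gram matrices are
the identity.

For a permutation operator the entries of G count coincidences in the two arrays. By
`sum_coincidence_eq_iff`, one Gram matrix is the identity iff the rows of K and the columns of L are
permutations; the other one exchanges K and L. Together they say that both arrays are latin, while
orthogonality is just injectivity of P. Since P and (K, L) determine each other, the bijection
follows, and exchanging K with L, which are distinct, accounts for the factor two. -/

/-! ### Unitary invariance of the uniform measure on the sphere. -/

section Sphere

variable {A : Type*} [NormedAddCommGroup A] [InnerProductSpace ℂ A]
    [FiniteDimensional ℂ A] [MeasurableSpace A] [BorelSpace A]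

/-- A linear isometry acting on the unit sphere. -/
noncomputable def sphereHomeomorph (T : A ≃ₗᵢ[ℂ] A) :
    Metric.sphere (0 : A) 1 ≃ₜ Metric.sphere (0 : A) 1 :=
  T.toHomeomorph.subtype fun x => by simp

omit [FiniteDimensional ℂ A] [MeasurableSpace A] [BorelSpace A] in
@[simp] lemma coe_sphereHomeomorph (T : A ≃ₗᵢ[ℂ] A) (x : Metric.sphere (0 : A) 1) :
    (sphereHomeomorph T x : A) = T x := rfl

/-- The pushforward of Haar measure is again Haar, hence a multiple of it; the invariant unit ball,
of positive finite measure, forces the factor 1. -/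
lemma addHaar_preimage_linearIsometryEquiv (T : A ≃ₗᵢ[ℂ] A) (s : Set A) :
    (let _ : ProperSpace A := FiniteDimensional.proper_rclike ℂ A
     (Measure.addHaar : Measure A) (T ⁻¹' s) = (Measure.addHaar : Measure A) s) := by
  let _ : ProperSpace A := FiniteDimensional.proper_rclike ℂ A
  set μ : Measure A := Measure.addHaar
  have hT : Measurable T := T.continuous.measurable
  have hH : (μ.map T).IsAddHaarMeasure :=
    T.toContinuousLinearEquiv.isAddHaarMeasure_map μ
  have h := Measure.isAddLeftInvariant_eq_smul (μ.map T) μ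
  set c := (μ.map T).addHaarScalarFactor μ
  have hc := h
  have hb : μ.map T (Metric.ball 0 1) = μ (Metric.ball 0 1) := by
    rw [Measure.map_apply hT Metric.isOpen_ball.measurableSet]
    congr 1
    ext x
    simp
  have hpos : μ (Metric.ball (0 : A) 1) ≠ 0 :=
    (Metric.isOpen_ball.measure_pos μ ⟨0, by simp⟩).ne'
  have hfin : μ (Metric.ball (0 : A) 1) ≠ ⊤ := measure_ball_lt_top.ne
  have hc1 : c = 1 := by
    rw [hc] at hb
    simp only [Measure.smul_apply] at hb
    exact by simpa [ENNReal.smul_def, ENNReal.mul_eq_right hpos hfin] using hb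
  have hmap : μ.map T = μ := by rw [hc, hc1, one_smul]
  calc μ (T ⁻¹' s) = μ.map T s :=
        (T.toHomeomorph.measurableEmbedding.map_apply μ s).symm
    _ = μ s := by rw [hmap]

open scoped Pointwise in
-- Surface measure is a constant times the Haar measure of the cone over a set, and `T` commutes
-- with real scaling, so cones pull back to cones.
lemma measurePreserving_sphereHomeomorph (T : A ≃ₗᵢ[ℂ] A) :
    MeasurePreserving (sphereHomeomorph T) (uniformSphere A) (uniformSphere A) := by
  let _ : ProperSpace A := FiniteDimensional.proper_rclike ℂ A
  have hm : Measurable (sphereHomeomorph T) := (sphereHomeomorph T).continuous.measurable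
  refine ⟨hm, ?_⟩
  ext s hs
  rw [Measure.map_apply hm hs]
  simp only [uniformSphere, Measure.smul_apply]
  congr 1
  rw [Measure.toSphere_apply' _ hs, Measure.toSphere_apply' _ (hm hs)]
  congr 1
  rw [← addHaar_preimage_linearIsometryEquiv T (Set.Ioo (0 : ℝ) 1 • (Subtype.val '' s))]
  congr 1
  ext x
  simp only [Set.mem_smul, Set.mem_image, Set.mem_preimage]
  constructor
  · rintro ⟨r, hr, _, ⟨y, hy, rfl⟩, rfl⟩
    refine ⟨r, hr, _, ⟨_, hy, rfl⟩, ?_⟩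
    exact ((T.toLinearEquiv.restrictScalars ℝ).map_smul r (y : A)).symm
  · rintro ⟨r, hr, _, ⟨y, hy, rfl⟩, h⟩
    refine ⟨r, hr, _, ⟨(sphereHomeomorph T).symm y, by simpa using hy, rfl⟩, ?_⟩
    apply T.injective
    rw [← h]
    have h1 := (T.toLinearEquiv.restrictScalars ℝ).map_smul r ((sphereHomeomorph T).symm y : A)
    have h2 : T ((sphereHomeomorph T).symm y : A) = y := by
      rw [← coe_sphereHomeomorph, Homeomorph.apply_symm_apply]
    exact h1.trans (congrArg (r • ·) h2)

lemma isProbabilityMeasure_uniformSphere [Nontrivial A] :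
    IsProbabilityMeasure (uniformSphere A) := by
  let _ : ProperSpace A := FiniteDimensional.proper_rclike ℂ A
  let _ : FiniteDimensional ℝ A := FiniteDimensional.complexToReal A
  constructor
  simp only [uniformSphere, Measure.smul_apply, smul_eq_mul]
  refine ENNReal.inv_mul_cancel ?_ (measure_ne_top _ _)
  rw [Ne, Measure.measure_univ_eq_zero]
  exact Measure.toSphere_ne_zero _

lemma integral_comp_linearIsometryEquiv (T : A ≃ₗᵢ[ℂ] A) (g : A → ℂ) :
    ∫ x : Metric.sphere (0 : A) 1, g (T x) ∂(uniformSphere A) =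
      ∫ x : Metric.sphere (0 : A) 1, g x ∂(uniformSphere A) :=
  (measurePreserving_sphereHomeomorph T).integral_comp
    (sphereHomeomorph T).measurableEmbedding (fun x => g x)

end Sphere

/-! ### Fourth moments of the coordinates of a random unit vector. -/

section Moments

lemma sum_mul_sum_mul_sum_mul_sum {R ι : Type*} [CommSemiring R] [Fintype ι] (a b c e : ι → R) :
    (∑ i, a i) * (∑ i, b i) * (∑ i, c i) * (∑ i, e i) =
      ∑ i, ∑ j, ∑ k, ∑ l, a i * b j * c k * e l := by
  simp only [← Finset.mul_sum, ← Finset.sum_mul]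

open scoped ComplexConjugate

variable {A : Type*} [NormedAddCommGroup A] [InnerProductSpace ℂ A]
    [FiniteDimensional ℂ A] [MeasurableSpace A] [BorelSpace A] {d : ℕ}

lemma integrable_uniformSphere [Nontrivial A] {g : Metric.sphere (0 : A) 1 → ℂ}
    (hg : Continuous g) : Integrable g (uniformSphere A) := by
  have := isProbabilityMeasure_uniformSphere (A := A)
  have : ProperSpace A := FiniteDimensional.proper_rclike ℂ A
  exact hg.integrable_of_hasCompactSupport (HasCompactSupport.of_compactSpace g)

/-- Averaging over the unit sphere, as a linear functional on the continuous functions. -/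
noncomputable def sphereAverage (A : Type*) [NormedAddCommGroup A] [InnerProductSpace ℂ A]
    [FiniteDimensional ℂ A] [MeasurableSpace A] [BorelSpace A] [Nontrivial A] :
    C(Metric.sphere (0 : A) 1, ℂ) →ₗ[ℂ] ℂ where
  toFun g := ∫ x, g x ∂(uniformSphere A)
  map_add' g h := integral_add (integrable_uniformSphere g.continuous)
    (integrable_uniformSphere h.continuous)
  map_smul' c _ := integral_const_mul c _

lemma sphereAverage_apply [Nontrivial A] (g : C(Metric.sphere (0 : A) 1, ℂ)) :
    sphereAverage A g = ∫ x, g x ∂(uniformSphere A) := rfl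

/-- The `i`-th coordinate as a continuous function on the unit sphere. -/
noncomputable def sphereCoord (e : OrthonormalBasis (Fin d) ℂ A) (i : Fin d) :
    C(Metric.sphere (0 : A) 1, ℂ) where
  toFun x := e.repr x i
  continuous_toFun := by fun_prop

omit [FiniteDimensional ℂ A] [MeasurableSpace A] [BorelSpace A] in
@[simp] lemma sphereCoord_apply (e : OrthonormalBasis (Fin d) ℂ A) (i : Fin d)
    (x : Metric.sphere (0 : A) 1) : sphereCoord e i x = e.repr x i := rfl

/-- The fourth moments of the coordinates of a uniformly distributed unit vector. -/
noncomputable def sphereMoment [Nontrivial A] (e : OrthonormalBasis (Fin d) ℂ A)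
    (i j k l : Fin d) : ℂ :=
  sphereAverage A (sphereCoord e i * star (sphereCoord e j) * sphereCoord e k *
    star (sphereCoord e l))

lemma sphereMoment_swap_right [Nontrivial A] (e : OrthonormalBasis (Fin d) ℂ A)
    (i j k l : Fin d) : sphereMoment e i j k l = sphereMoment e i l k j := by
  unfold sphereMoment; congr 1; ring

lemma sphereMoment_swap_left [Nontrivial A] (e : OrthonormalBasis (Fin d) ℂ A)
    (i j k l : Fin d) : sphereMoment e i j k l = sphereMoment e k j i l := by
  unfold sphereMoment; congr 1; ring

lemma sphereMoment_eq_of_isometry [Nontrivial A] (e : OrthonormalBasis (Fin d) ℂ A)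
    (T : A ≃ₗᵢ[ℂ] A) (i j k l : Fin d) :
    ∫ x : Metric.sphere (0 : A) 1, e.repr (T x) i * conj (e.repr (T x) j) * e.repr (T x) k *
      conj (e.repr (T x) l) ∂(uniformSphere A) = sphereMoment e i j k l :=
  integral_comp_linearIsometryEquiv T fun x =>
    e.repr x i * conj (e.repr x j) * e.repr x k * conj (e.repr x l)

omit [FiniteDimensional ℂ A] [MeasurableSpace A] [BorelSpace A] in
lemma exists_isometry_phase (e : OrthonormalBasis (Fin d) ℂ A) (t : Fin d) :
    ∃ T : A ≃ₗᵢ[ℂ] A, ∀ x i,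
      e.repr (T x) i = (if i = t then Complex.I else 1) * e.repr x i := by
  let ω : Fin d → unitary ℂ := fun i =>
    if i = t then ⟨Complex.I, by simp [Unitary.mem_iff]⟩ else 1
  refine ⟨(e.repr.trans (LinearIsometryEquiv.piLpCongrRight 2
    fun i => Unitary.mulLeft ℂ ℂ (ω i))).trans e.repr.symm, fun x i => ?_⟩
  simp only [LinearIsometryEquiv.trans_apply, LinearIsometryEquiv.apply_symm_apply,
    LinearIsometryEquiv.piLpCongrRight_apply]
  by_cases h : i = t <;> simp [ω, h]

lemma sphereMoment_eq_phase_mul [Nontrivial A] (e : OrthonormalBasis (Fin d) ℂ A)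
    (t i j k l : Fin d) :
    sphereMoment e i j k l = ((if i = t then Complex.I else 1) *
      conj (if j = t then Complex.I else 1) * (if k = t then Complex.I else 1) *
      conj (if l = t then Complex.I else 1)) * sphereMoment e i j k l := by
  obtain ⟨T, hT⟩ := exists_isometry_phase e t
  conv_lhs => rw [← sphereMoment_eq_of_isometry e T]
  rw [sphereMoment, sphereAverage_apply, ← integral_const_mul]
  congr 1
  ext x
  simp only [hT, map_mul, ContinuousMap.mul_apply, ContinuousMap.star_apply, sphereCoord_apply,
    Complex.star_def]
  ring

/-- Multiplying the coordinate `t` by `I` multiplies the moment by `I ^ n`, where `n` counts the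
plain minus the conjugated occurrences of `t`. As |n| ≤ 2 and `I` has order 4, a nonzero moment
needs n = 0 for every `t`. -/
lemma sphereMoment_support [Nontrivial A] (e : OrthonormalBasis (Fin d) ℂ A)
    {i j k l : Fin d} (h : sphereMoment e i j k l ≠ 0) : (i = j ∧ k = l) ∨ (i = l ∧ k = j) := by
  have key : ∀ t, ((if i = t then Complex.I else 1) *
      conj (if j = t then Complex.I else 1) * (if k = t then Complex.I else 1) *
      conj (if l = t then Complex.I else 1)) = 1 := fun t =>
    (mul_eq_right₀ h).1 (sphereMoment_eq_phase_mul e t i j k l).symm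
  have hI : Complex.I ≠ 1 := fun h => by simpa using congrArg Complex.re h
  have hI' : -Complex.I ≠ 1 := fun h => by simpa using congrArg Complex.re h
  have hn : (-1 : ℂ) ≠ 1 := by norm_num
  -- Without a conjugated partner for `i` the phase would be `I` or `-1`.
  have hi : j = i ∨ l = i := by
    by_contra! hh
    have h1 := key i
    rw [if_pos rfl, if_neg hh.1, if_neg hh.2] at h1
    by_cases c : k = i
    · simp [c, hn] at h1
    · simp [c, hI] at h1
  rcases hi with rfl | rfl
  · refine Or.inl ⟨rfl, ?_⟩
    by_contra hh
    have h2 := key k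
    by_cases c : j = k <;> simp [c, Ne.symm hh, hI] at h2
  · refine Or.inr ⟨rfl, ?_⟩
    by_contra hh
    have h2 := key k
    by_cases c : l = k <;> simp [c, Ne.symm hh, hI] at h2

omit [FiniteDimensional ℂ A] [MeasurableSpace A] [BorelSpace A] in
-- Reflection in the line spanned by 2e_i + e_j: this vector has squared norm 5, which keeps the
-- matrix rational.
lemma exists_isometry_rotation (e : OrthonormalBasis (Fin d) ℂ A) {i j : Fin d} (hij : i ≠ j) :
    ∃ T : A ≃ₗᵢ[ℂ] A, ∀ x, e.repr (T x) i = (3 * e.repr x i + 4 * e.repr x j) / 5 ∧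
      e.repr (T x) j = (4 * e.repr x i - 3 * e.repr x j) / 5 := by
  set v : A := (2 : ℂ) • e i + e j with hv
  have hn : (RCLike.ofReal (‖v‖ ^ 2) : ℂ) = 5 := by
    have h := inner_self_eq_norm_sq_to_K (𝕜 := ℂ) v
    rw [RCLike.ofReal_pow]
    refine h.symm.trans ?_
    rw [hv]
    simp only [inner_add_left, inner_add_right, inner_smul_left, inner_smul_right,
      orthonormal_iff_ite.1 e.orthonormal, hij, hij.symm, if_true, if_false, map_ofNat]
    norm_num
  refine ⟨(Submodule.span ℂ {v}).reflection, fun x => ?_⟩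
  have hr : ∀ k, e.repr ((Submodule.span ℂ {v}).reflection x) k =
      2 * ((2 * e.repr x i + e.repr x j) / 5 * e.repr v k) - e.repr x k := by
    intro k
    have hx : inner ℂ v x = 2 * e.repr x i + e.repr x j := by
      rw [hv, inner_add_left, inner_smul_left, e.repr_apply_apply, e.repr_apply_apply, map_ofNat]
    rw [Submodule.reflection_apply, Submodule.starProjection_singleton, hn, hx, map_sub, map_nsmul,
      map_smul]
    clear_value v
    simp
  have hvi : e.repr v i = 2 := by
    simp [hv, hij]
  have hvj : e.repr v j = 1 := by
    simp [hv, hij.symm]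
  rw [hr, hr, hvi, hvj]
  constructor <;> ring

/-- Of the sixteen terms of the expansion, the ten unbalanced ones vanish by `sphereMoment_support`;
the four balanced mixed terms agree by the swap symmetries. -/
lemma sphereMoment_rotation [Nontrivial A] (e : OrthonormalBasis (Fin d) ℂ A) {i j : Fin d}
    (hij : i ≠ j) (a b : ℝ)
    (T : A ≃ₗᵢ[ℂ] A) (t : Fin d) (hT : ∀ x, e.repr (T x) t = a * e.repr x i + b * e.repr x j) :
    sphereMoment e t t t t = a ^ 4 * sphereMoment e i i i i + b ^ 4 * sphereMoment e j j j j +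
      4 * a ^ 2 * b ^ 2 * sphereMoment e i i j j := by
  have hz : ∀ {p q r s : Fin d}, ¬ ((p = q ∧ r = s) ∨ (p = s ∧ r = q)) →
      sphereMoment e p q r s = 0 := fun h => by
    by_contra h'
    exact h (sphereMoment_support e h')
  rw [← sphereMoment_eq_of_isometry e T]
  simp only [hT]
  set x := sphereCoord e i with hx
  set y := sphereCoord e j with hy
  have hexp : sphereAverage A (((a : ℂ) • x + (b : ℂ) • y) * star ((a : ℂ) • x + (b : ℂ) • y) *
      ((a : ℂ) • x + (b : ℂ) • y) * star ((a : ℂ) • x + (b : ℂ) • y)) =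
      a ^ 4 * sphereMoment e i i i i + b ^ 4 * sphereMoment e j j j j +
      4 * a ^ 2 * b ^ 2 * sphereMoment e i i j j := by
    have h1 := sphereMoment_swap_right e i i j j
    have h2 := sphereMoment_swap_left e i i j j
    have h3 := (sphereMoment_swap_left e i j j i).symm
    have hfold : ∀ p q r s, sphereAverage A (sphereCoord e p * star (sphereCoord e q) *
        sphereCoord e r * star (sphereCoord e s)) = sphereMoment e p q r s := fun _ _ _ _ => rfl
    simp only [star_add, star_smul, add_mul, mul_add, smul_mul_assoc, mul_smul_comm, map_add,
      map_smul, hx, hy, smul_add, Complex.star_def, Complex.conj_ofReal]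
    simp only [hfold]
    rw [hz (p := i) (q := i) (r := i) (s := j) (by simp [hij]),
      hz (p := i) (q := i) (r := j) (s := i) (by simp [hij.symm]),
      hz (p := i) (q := j) (r := i) (s := i) (by simp [hij]),
      hz (p := j) (q := i) (r := i) (s := i) (by simp [hij.symm]),
      hz (p := j) (q := j) (r := j) (s := i) (by simp [hij.symm]),
      hz (p := j) (q := j) (r := i) (s := j) (by simp [hij]),
      hz (p := j) (q := i) (r := j) (s := j) (by simp [hij.symm]),
      hz (p := i) (q := j) (r := j) (s := j) (by simp [hij]),
      hz (p := i) (q := j) (r := i) (s := j) (by simp [hij]),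
      hz (p := j) (q := i) (r := j) (s := i) (by simp [hij.symm]),
      h3, ← h2, ← h1]
    simp only [smul_eq_mul]
    ring
  exact hexp

lemma sphereMoment_diag [Nontrivial A] (e : OrthonormalBasis (Fin d) ℂ A) {i j : Fin d}
    (hij : i ≠ j) : sphereMoment e i i i i = sphereMoment e j j j j ∧
      sphereMoment e i i i i = 2 * sphereMoment e i i j j := by
  obtain ⟨T, hT⟩ := exists_isometry_rotation e hij
  have h1 := sphereMoment_rotation e hij (3 / 5) (4 / 5) T i fun x => by
    rw [(hT x).1]; push_cast; ring
  have h2 := sphereMoment_rotation e hij (4 / 5) (-3 / 5) T j fun x => by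
    rw [(hT x).2]; push_cast; ring
  push_cast at h1 h2
  constructor
  -- The fourth powers of the coefficients are 81/625 and 256/625. Subtracting the two relations
  -- leaves 800/625 times the difference of the diagonal moments; then 288 = 625 − 81 − 256 is
  -- compared with 576 = 4·9·16.
  · linear_combination (625 / 800 : ℂ) * (h1 - h2)
  · linear_combination (625 / 288 : ℂ) * h1 - (256 / 288 * (625 / 800) : ℂ) * (h1 - h2)

/-- This is the mean of (∑ |x_i|²)², which is constantly 1 on the sphere; it fixes the
normalization. -/
lemma sum_sphereMoment [Nontrivial A] (e : OrthonormalBasis (Fin d) ℂ A) :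
    ∑ i, ∑ j, sphereMoment e i i j j = 1 := by
  have := isProbabilityMeasure_uniformSphere (A := A)
  have h : (∑ i, sphereCoord e i * star (sphereCoord e i)) = 1 := by
    ext x
    have h1 := e.sum_sq_norm_inner_right (x : A)
    rw [mem_sphere_zero_iff_norm.1 x.2, one_pow] at h1
    simp only [ContinuousMap.coe_sum, Finset.sum_apply, ContinuousMap.mul_apply,
      ContinuousMap.star_apply, sphereCoord_apply, Complex.star_def, Complex.mul_conj,
      ContinuousMap.one_apply, Complex.normSq_eq_norm_sq, e.repr_apply_apply]
    exact_mod_cast h1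
  have h2 : sphereAverage A ((∑ i, sphereCoord e i * star (sphereCoord e i)) *
      ∑ i, sphereCoord e i * star (sphereCoord e i)) = 1 := by
    rw [h, sphereAverage_apply]
    simp
  rw [← h2, Finset.sum_mul_sum, map_sum]
  refine Finset.sum_congr rfl fun i _ => ?_
  rw [map_sum]
  refine Finset.sum_congr rfl fun j _ => ?_
  rw [sphereMoment, ← mul_assoc]

theorem sphereMoment_eq [Nontrivial A] (e : OrthonormalBasis (Fin d) ℂ A) (i j k l : Fin d) :
    sphereMoment e i j k l = ((if i = j then 1 else 0) * (if k = l then 1 else 0) +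
      (if i = l then 1 else 0) * (if k = j then 1 else 0)) / (d * (d + 1)) := by
  have hd : (d : ℂ) ≠ 0 := by
    have : 0 < d := i.pos
    exact_mod_cast this.ne'
  have hd' : (d : ℂ) + 1 ≠ 0 := by exact_mod_cast d.succ_ne_zero
  set α := sphereMoment e i i i i with hα
  have hαc : ∀ j, sphereMoment e j j j j = α := fun j => by
    by_cases h : i = j
    · rw [← h]
    · exact (sphereMoment_diag e h).1.symm
  have hβ : ∀ p q, sphereMoment e p p q q = α / 2 * (1 + if p = q then 1 else 0) := fun p q => by
    by_cases h : p = q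
    · subst h; rw [hαc, if_pos rfl]; ring
    · rw [← hαc p, (sphereMoment_diag e h).2, if_neg h]; ring
  -- Summing `hβ` over all pairs gives (α/2)(d² + d) = 1.
  have hval : α / 2 = 1 / (d * (d + 1)) := by
    have h := sum_sphereMoment e
    simp only [hβ, mul_add, Finset.sum_add_distrib, mul_one, mul_ite, mul_zero,
      Finset.sum_ite_eq, Finset.mem_univ, if_true, Finset.sum_const, Finset.card_univ,
      Fintype.card_fin, nsmul_eq_mul] at h
    field_simp
    linear_combination 2 * h
  by_cases h : (i = j ∧ k = l) ∨ (i = l ∧ k = j)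
  · rcases h with ⟨rfl, rfl⟩ | ⟨rfl, rfl⟩
    · rw [hβ, hval]
      by_cases h : i = k <;> simp [h, field]
    · rw [sphereMoment_swap_right, hβ, hval]
      by_cases h : i = k <;> simp [h, field]
  · have : sphereMoment e i j k l = 0 := by
      by_contra h'
      exact h (sphereMoment_support e h')
    rw [this]
    by_cases a : i = j <;> by_cases b : k = l <;> by_cases c : i = l <;> by_cases f : k = j <;>
      simp_all

/-- The mean of a product of two linear forms and two conjugate linear forms in the coordinates
of a uniformly distributed unit vector. -/
theorem integral_linearForms [Nontrivial A] (e : OrthonormalBasis (Fin d) ℂ A)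
    (p q r s : Fin d → ℂ) :
    ∫ x : Metric.sphere (0 : A) 1, (∑ i, p i * e.repr x i) * conj (∑ i, q i * e.repr x i) *
      (∑ i, r i * e.repr x i) * conj (∑ i, s i * e.repr x i) ∂(uniformSphere A) =
    ((∑ i, p i * conj (q i)) * (∑ i, r i * conj (s i)) +
      (∑ i, p i * conj (s i)) * (∑ i, r i * conj (q i))) / (d * (d + 1)) := by
  have h : sphereAverage A ((∑ i, p i • sphereCoord e i) * star (∑ i, q i • sphereCoord e i) *
      (∑ i, r i • sphereCoord e i) * star (∑ i, s i • sphereCoord e i)) =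
      ∑ i, ∑ j, ∑ k, ∑ l, p i * conj (q j) * r k * conj (s l) * sphereMoment e i j k l := by
    rw [star_sum, star_sum, sum_mul_sum_mul_sum_mul_sum]
    simp only [map_sum]
    refine Finset.sum_congr rfl fun i _ => Finset.sum_congr rfl fun j _ =>
      Finset.sum_congr rfl fun k _ => Finset.sum_congr rfl fun l _ => ?_
    simp only [star_smul, smul_mul_assoc, mul_smul_comm, map_smul, smul_eq_mul, sphereMoment,
      Complex.star_def]
    ring
  have h' : ∀ x : Metric.sphere (0 : A) 1,
      ((∑ i, p i • sphereCoord e i) * star (∑ i, q i • sphereCoord e i) *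
        (∑ i, r i • sphereCoord e i) * star (∑ i, s i • sphereCoord e i)) x =
      (∑ i, p i * e.repr x i) * conj (∑ i, q i * e.repr x i) *
      (∑ i, r i * e.repr x i) * conj (∑ i, s i * e.repr x i) := fun x => by
    simp
  rw [sphereAverage_apply] at h
  simp only [h'] at h
  rw [h]
  simp only [sphereMoment_eq, mul_div_assoc', ← Finset.sum_div]
  congr 1
  simp only [mul_add, Finset.sum_add_distrib, Finset.sum_mul_sum]
  congr 1
  · simp only [mul_ite, mul_one, mul_zero, Finset.sum_ite_eq,
      Finset.mem_univ, if_true, Finset.sum_ite_irrel, Finset.sum_const_zero]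
    refine Finset.sum_congr rfl fun i _ => Finset.sum_congr rfl fun k _ => ?_
    ring
  · simp only [mul_ite, mul_one, mul_zero, Finset.sum_ite_eq,
      Finset.mem_univ, if_true, Finset.sum_ite_irrel, Finset.sum_const_zero]
    rw [Finset.sum_congr rfl fun i _ => Finset.sum_comm]
    simp only [Finset.sum_ite_eq, Finset.mem_univ, if_true]
    refine Finset.sum_congr rfl fun i _ => Finset.sum_congr rfl fun k _ => ?_
    ring

end Moments

/-! ### The purity Tr ρ² and the operator in coordinates. -/

section Purity

open scoped ComplexConjugate

variable {A B : Type*} [NormedAddCommGroup A] [InnerProductSpace ℂ A] [FiniteDimensional ℂ A]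
    [NormedAddCommGroup B] [InnerProductSpace ℂ B] [FiniteDimensional ℂ B] {d : ℕ}

/-- Both sides are linear in `X`, so it suffices to treat S ⊗ T, where the trace of T expands in
`f`. -/
lemma inner_partialTraceRight (f : OrthonormalBasis (Fin d) ℂ B)
    (X : A ⊗[ℂ] B →ₗ[ℂ] A ⊗[ℂ] B) (a a' : A) :
    inner ℂ a (partialTraceRight A B X a') =
      ∑ l, inner ℂ (a ⊗ₜ[ℂ] f l) (X (a' ⊗ₜ[ℂ] f l)) := by
  obtain ⟨Y, rfl⟩ := (homTensorHomEquiv ℂ A B A B).surjective X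
  induction Y using TensorProduct.induction_on with
  | zero => simp
  | tmul S T =>
    simp only [partialTraceRight, LinearMap.comp_apply, LinearEquiv.coe_coe]
    rw [LinearEquiv.symm_apply_apply]
    simp only [ LinearMap.lTensor_tmul, TensorProduct.rid_tmul,
      LinearMap.smul_apply, inner_smul_right, homTensorHomEquiv_apply,
      TensorProduct.homTensorHomMap_apply,
      TensorProduct.map_tmul, TensorProduct.inner_tmul, LinearMap.trace_eq_sum_inner T f]
    rw [Finset.sum_mul]
    exact Finset.sum_congr rfl fun l _ => mul_comm _ _
  | add Y Z hY hZ =>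
    simp only [map_add, LinearMap.add_apply, inner_add_right, Finset.sum_add_distrib, hY, hZ]

lemma inner_reducedState (e : OrthonormalBasis (Fin d) ℂ A) (f : OrthonormalBasis (Fin d) ℂ B)
    (ψ : A ⊗[ℂ] B) (k k' : Fin d) :
    inner ℂ (e k) (reducedState ψ (e k')) = ∑ l, inner ℂ (e k ⊗ₜ[ℂ] f l) ψ *
      conj (inner ℂ (e k' ⊗ₜ[ℂ] f l) ψ) := by
  rw [reducedState, inner_partialTraceRight f]
  refine Finset.sum_congr rfl fun l _ => ?_
  rw [ContinuousLinearMap.coe_coe, InnerProductSpace.rankOne_apply, inner_smul_right,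
    ← inner_conj_symm (𝕜 := ℂ) ψ, mul_comm]

/-- Plain and conjugated factors alternate, matching the quartic forms of `integral_linearForms`. -/
lemma trace_reducedState_sq (e : OrthonormalBasis (Fin d) ℂ A) (f : OrthonormalBasis (Fin d) ℂ B)
    (ψ : A ⊗[ℂ] B) :
    LinearMap.trace ℂ A (reducedState ψ ∘ₗ reducedState ψ) =
      ∑ k, ∑ k', ∑ l, ∑ l', inner ℂ (e k ⊗ₜ[ℂ] f l) ψ * conj (inner ℂ (e k' ⊗ₜ[ℂ] f l) ψ) *
        inner ℂ (e k' ⊗ₜ[ℂ] f l') ψ * conj (inner ℂ (e k ⊗ₜ[ℂ] f l') ψ) := by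
  rw [LinearMap.trace_eq_sum_inner _ e]
  refine Finset.sum_congr rfl fun k _ => ?_
  have h : ∀ a : A, inner ℂ (e k) (reducedState ψ a) =
      ∑ k', inner ℂ (e k) (reducedState ψ (e k')) * inner ℂ (e k') a := by
    intro a
    conv_lhs => rw [← e.sum_repr' a]
    simp only [map_sum, map_smul, inner_sum, inner_smul_right]
    exact Finset.sum_congr rfl fun _ _ => mul_comm _ _
  rw [LinearMap.comp_apply, h]
  refine Finset.sum_congr rfl fun k' _ => ?_
  rw [inner_reducedState e f, inner_reducedState e f, Finset.sum_mul_sum]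
  refine Finset.sum_congr rfl fun l _ => Finset.sum_congr rfl fun l' _ => ?_
  ring

/-- The matrix coefficients `⟨kl|U|ij⟩` of an operator in the product basis. -/
noncomputable def tensorCoeff (e : OrthonormalBasis (Fin d) ℂ A) (f : OrthonormalBasis (Fin d) ℂ B)
    (U : A ⊗[ℂ] B ≃ₗᵢ[ℂ] A ⊗[ℂ] B) (k l i j : Fin d) : ℂ :=
  inner ℂ (e k ⊗ₜ[ℂ] f l) (U (e i ⊗ₜ[ℂ] f j))

omit [FiniteDimensional ℂ A] [FiniteDimensional ℂ B] in
-- For fixed `a` this is a linear form in the coordinates of `b`, with coefficients linear in `a`;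
-- hence the two spheres can be integrated one after the other.
lemma inner_tmul_isometry (e : OrthonormalBasis (Fin d) ℂ A) (f : OrthonormalBasis (Fin d) ℂ B)
    (U : A ⊗[ℂ] B ≃ₗᵢ[ℂ] A ⊗[ℂ] B) (k l : Fin d) (a : A) (b : B) :
    inner ℂ (e k ⊗ₜ[ℂ] f l) (U (a ⊗ₜ[ℂ] b)) =
      ∑ j, (∑ i, tensorCoeff e f U k l i j * e.repr a i) * f.repr b j := by
  conv_lhs => rw [← e.sum_repr a, ← f.sum_repr b]
  rw [TensorProduct.tmul_sum, map_sum, inner_sum]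
  refine Finset.sum_congr rfl fun j _ => ?_
  rw [TensorProduct.sum_tmul, map_sum, inner_sum, Finset.sum_mul]
  refine Finset.sum_congr rfl fun i _ => ?_
  rw [TensorProduct.tmul_smul, ← TensorProduct.smul_tmul', map_smul, map_smul]
  have h (c : ℂ) (x : A ⊗[ℂ] B) : inner ℂ (e k ⊗ₜ[ℂ] f l) (c • x) =
      c * inner ℂ (e k ⊗ₜ[ℂ] f l) x := map_smul (innerₛₗ ℂ (e k ⊗ₜ[ℂ] f l)) c x
  refine (h _ _).trans ?_
  rw [h, tensorCoeff]
  ring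

omit [FiniteDimensional ℂ A] [FiniteDimensional ℂ B] in
-- Parseval's identity for the images of two product basis vectors under the inverse of `U`.
lemma sum_tensorCoeff_mul_conj (e : OrthonormalBasis (Fin d) ℂ A)
    (f : OrthonormalBasis (Fin d) ℂ B) (U : A ⊗[ℂ] B ≃ₗᵢ[ℂ] A ⊗[ℂ] B) (k l k' l' : Fin d) :
    ∑ j, ∑ i, tensorCoeff e f U k l i j * conj (tensorCoeff e f U k' l' i j) =
      (if k = k' then 1 else 0) * (if l = l' then 1 else 0) := by
  have h := (e.tensorProduct f).sum_inner_mul_inner (U.symm (e k ⊗ₜ[ℂ] f l))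
    (U.symm (e k' ⊗ₜ[ℂ] f l'))
  rw [LinearIsometryEquiv.inner_map_map, TensorProduct.inner_tmul,
    orthonormal_iff_ite.1 e.orthonormal, orthonormal_iff_ite.1 f.orthonormal,
    Fintype.sum_prod_type_right] at h
  rw [← h]
  refine Finset.sum_congr rfl fun j _ => Finset.sum_congr rfl fun i _ => ?_
  rw [OrthonormalBasis.tensorProduct_apply, tensorCoeff, tensorCoeff,
    ← U.inner_map_map (U.symm _), ← U.inner_map_map _ (U.symm _), U.apply_symm_apply,
    U.apply_symm_apply, ← inner_conj_symm (𝕜 := ℂ) (U _) (e k' ⊗ₜ[ℂ] f l')]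

end Purity

/-! ### The closed formula for the entangling power. -/

section EntanglingPower

open scoped ComplexConjugate

variable {d : ℕ}

lemma sum_reorder_six {ι M : Type*} [Fintype ι] [AddCommMonoid M] (F : ι → ι → ι → ι → ι → ι → M) :
    ∑ k, ∑ k', ∑ l, ∑ l', ∑ j, ∑ j', F k k' l l' j j' =
      ∑ l, ∑ j, ∑ l', ∑ j', ∑ k, ∑ k', F k k' l l' j j' := by
  let σ : ι × ι × ι × ι × ι × ι ≃ ι × ι × ι × ι × ι × ι :=
    { toFun := fun ⟨k, k', l, l', j, j'⟩ => ⟨l, j, l', j', k, k'⟩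
      invFun := fun ⟨l, j, l', j', k, k'⟩ => ⟨k, k', l, l', j, j'⟩
      left_inv := fun _ => rfl
      right_inv := fun _ => rfl }
  have h := Fintype.sum_equiv σ
    (fun x => F x.1 x.2.1 x.2.2.1 x.2.2.2.1 x.2.2.2.2.1 x.2.2.2.2.2)
    (fun x => F x.2.2.2.2.1 x.2.2.2.2.2 x.1 x.2.2.1 x.2.1 x.2.2.2.1) (fun _ => rfl)
  simpa only [Fintype.sum_prod_type] using h

lemma sum_comm_pairs {ι M : Type*} [Fintype ι] [AddCommMonoid M] (F : ι → ι → ι → ι → M) :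
    ∑ a, ∑ b, ∑ c, ∑ d, F a b c d = ∑ c, ∑ d, ∑ a, ∑ b, F a b c d := by
  have h := Finset.sum_comm (s := (Finset.univ : Finset (ι × ι)))
    (t := (Finset.univ : Finset (ι × ι)))
    (f := fun x y => F x.1 x.2 y.1 y.2)
  simpa only [Fintype.sum_prod_type] using h

/-- The Gram matrix, with rows indexed by `(l, j)`, of the reshuffling of the operator with
coefficients `u k l i j` that groups the indices `(l, j)` and `(k, i)`. -/
noncomputable def gramRight (u : Fin d → Fin d → Fin d → Fin d → ℂ) (l j l' j' : Fin d) : ℂ :=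
  ∑ k, ∑ i, u k l i j * conj (u k l' i j')

/-- The squared Hilbert–Schmidt distance of `gramRight u` to the identity. -/
noncomputable def gramDefect (u : Fin d → Fin d → Fin d → Fin d → ℂ) : ℝ :=
  ∑ l, ∑ j, ∑ l', ∑ j', Complex.normSq
    (gramRight u l j l' j' - (if l = l' then 1 else 0) * (if j = j' then 1 else 0))

/-- Exchange of the two output indices. -/
def swapOutput (u : Fin d → Fin d → Fin d → Fin d → ℂ) : Fin d → Fin d → Fin d → Fin d → ℂ :=
  fun k l => u l k

/-- Orthonormality of the rows of the matrix with coefficients `u k l i j`. -/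
def RowOrthonormal (u : Fin d → Fin d → Fin d → Fin d → ℂ) : Prop :=
  ∀ k l k' l', ∑ j, ∑ i, u k l i j * conj (u k' l' i j) =
    (if k = k' then 1 else 0) * (if l = l' then 1 else 0)

lemma RowOrthonormal.swapOutput {u : Fin d → Fin d → Fin d → Fin d → ℂ} (h : RowOrthonormal u) :
    RowOrthonormal (swapOutput u) := fun k l k' l' => by
  rw [mul_comm]
  exact h l k l' k'

lemma gramRight_conj (u : Fin d → Fin d → Fin d → Fin d → ℂ) (l j l' j' : Fin d) :
    gramRight u l' j' l j = conj (gramRight u l j l' j') := by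
  simp only [gramRight, map_sum, map_mul, Complex.conj_conj, mul_comm]

lemma gramDefect_nonneg (u : Fin d → Fin d → Fin d → Fin d → ℂ) : 0 ≤ gramDefect u :=
  Finset.sum_nonneg fun _ _ => Finset.sum_nonneg fun _ _ => Finset.sum_nonneg fun _ _ =>
    Finset.sum_nonneg fun _ _ => Complex.normSq_nonneg _

lemma gramDefect_eq_zero_iff (u : Fin d → Fin d → Fin d → Fin d → ℂ) :
    gramDefect u = 0 ↔ ∀ l j l' j', gramRight u l j l' j' =
      (if l = l' then 1 else 0) * (if j = j' then 1 else 0) := by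
  have h : gramDefect u = ∑ x : Fin d × Fin d × Fin d × Fin d, Complex.normSq
      (gramRight u x.1 x.2.1 x.2.2.1 x.2.2.2 -
        (if x.1 = x.2.2.1 then 1 else 0) * (if x.2.1 = x.2.2.2 then 1 else 0)) := by
    simp only [gramDefect, Fintype.sum_prod_type]
  rw [h, Finset.sum_eq_zero_iff_of_nonneg fun _ _ => Complex.normSq_nonneg _]
  simp only [Finset.mem_univ, true_imp_iff, Complex.normSq_eq_zero, sub_eq_zero, Prod.forall]

/-- The trace is the total squared norm of the coefficients, that is, of d² unit rows. -/
lemma RowOrthonormal.trace_gramRight {u : Fin d → Fin d → Fin d → Fin d → ℂ}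
    (h : RowOrthonormal u) : ∑ l, ∑ j, gramRight u l j l j = (d : ℂ) ^ 2 := by
  have h1 : ∀ k l, ∑ j, ∑ i, u k l i j * conj (u k l i j) = 1 := fun k l => by
    rw [h]; simp
  calc ∑ l, ∑ j, gramRight u l j l j
      = ∑ l, ∑ k, ∑ j, ∑ i, u k l i j * conj (u k l i j) :=
        Finset.sum_congr rfl fun l _ => Finset.sum_comm
    _ = (d : ℂ) ^ 2 := by simp only [h1]; simp [sq]

/-- G is Hermitian, so the left side is ‖G‖²; expand ‖G − 1‖² = ‖G‖² − 2 Tr G + d² with Tr G = d².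
-/
lemma RowOrthonormal.sum_gramRight_mul {u : Fin d → Fin d → Fin d → Fin d → ℂ}
    (h : RowOrthonormal u) :
    ∑ l, ∑ j, ∑ l', ∑ j', gramRight u l j l' j' * gramRight u l' j' l j =
      ((d ^ 2 + gramDefect u : ℝ) : ℂ) := by
  have hterm : ∀ l j l' j', ((Complex.normSq (gramRight u l j l' j' -
      (if l = l' then 1 else 0) * (if j = j' then 1 else 0)) : ℝ) : ℂ) =
      gramRight u l j l' j' * gramRight u l' j' l j -
        (if l = l' then if j = j' then gramRight u l j l' j' + gramRight u l' j' l j - 1 else 0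
          else 0) := by
    intro l j l' j'
    rw [← Complex.mul_conj, map_sub, ← gramRight_conj]
    by_cases a : l = l' <;> by_cases b : j = j' <;> simp [a, b]
    ring
  have htr := h.trace_gramRight
  have hd : ((gramDefect u : ℝ) : ℂ) =
      ∑ l, ∑ j, ∑ l', ∑ j', gramRight u l j l' j' * gramRight u l' j' l j - (d : ℂ) ^ 2 := by
    rw [gramDefect]
    push_cast
    simp only [hterm, Finset.sum_sub_distrib, Finset.sum_ite_irrel, Finset.sum_ite_eq,
      Finset.mem_univ, if_true, Finset.sum_const_zero, Finset.sum_add_distrib, htr]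
    simp [sq]
  push_cast
  rw [hd]
  ring

/-- The mean of the quartic form `x_p * conj x_q * x_r * conj x_s` over product vectors, up to the
normalization, where the `x`'s are bilinear forms with the given coefficients. -/
noncomputable def productMoment (p q r s : Fin d → Fin d → ℂ) : ℂ :=
  ((∑ j, ∑ i, p i j * conj (q i j)) * (∑ j, ∑ i, r i j * conj (s i j)) +
    ∑ j, ∑ j', (∑ i, p i j * conj (s i j')) * (∑ i, r i j' * conj (q i j))) +
  ((∑ j, ∑ i, p i j * conj (s i j)) * (∑ j, ∑ i, r i j * conj (q i j)) +
    ∑ j, ∑ j', (∑ i, p i j * conj (q i j')) * (∑ i, r i j' * conj (s i j)))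

/-- The products of full row inner products reduce to δ_kk' and δ_ll', contributing d³ each; the two
remaining sums are the squared norms of the two Gram matrices. -/
lemma RowOrthonormal.sum_productMoment {u : Fin d → Fin d → Fin d → Fin d → ℂ}
    (h : RowOrthonormal u) :
    ∑ k, ∑ k', ∑ l, ∑ l', productMoment (u k l) (u k' l) (u k' l') (u k l') =
      ((2 * d ^ 3 + 2 * d ^ 2 + gramDefect u + gramDefect (_root_.swapOutput u) : ℝ) : ℂ) := by
  have h1 : ∑ l, ∑ j, ∑ l', ∑ j', gramRight u l j l' j' * gramRight u l' j' l j =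
      ∑ k, ∑ k', ∑ l, ∑ l', ∑ j, ∑ j', (∑ i, u k l i j * conj (u k l' i j')) *
        (∑ i, u k' l' i j' * conj (u k' l i j)) := by
    rw [sum_reorder_six]
    simp only [gramRight, Finset.sum_mul_sum (Finset.univ : Finset (Fin d)) Finset.univ
      (fun k => ∑ i, _) (fun k => ∑ i, _)]
  have h2 : ∑ l, ∑ j, ∑ l', ∑ j', gramRight (_root_.swapOutput u) l j l' j' *
      gramRight (_root_.swapOutput u) l' j' l j =
      ∑ k, ∑ k', ∑ l, ∑ l', ∑ j, ∑ j', (∑ i, u k l i j * conj (u k' l i j')) *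
        (∑ i, u k' l' i j' * conj (u k l' i j)) := by
    -- Exchanging the output pairs (k, k') and (l, l') reduces this to the same reordering as in
    -- `h1`.
    have := sum_reorder_six fun l l' k k' j j' => (∑ i, u k l i j * conj (u k' l i j')) *
        (∑ i, u k' l' i j' * conj (u k l' i j))
    simp only [gramRight, _root_.swapOutput, Finset.sum_mul_sum (Finset.univ : Finset (Fin d))
      Finset.univ (fun k => ∑ i, _) (fun k => ∑ i, _)]
    rw [← this]
    exact sum_comm_pairs _
  rw [h.sum_gramRight_mul] at h1
  rw [h.swapOutput.sum_gramRight_mul] at h2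
  simp only [productMoment, Finset.sum_add_distrib, ← h1, ← h2, h _ _ _ _]
  simp
  ring

variable {A B : Type*} [NormedAddCommGroup A] [InnerProductSpace ℂ A] [FiniteDimensional ℂ A]
    [MeasurableSpace A] [BorelSpace A]
    [NormedAddCommGroup B] [InnerProductSpace ℂ B] [FiniteDimensional ℂ B]
    [MeasurableSpace B] [BorelSpace B]

lemma integral_const_mul_one_sub_re [Nontrivial A] (c : ℝ) {g : Metric.sphere (0 : A) 1 → ℂ}
    (hg : Continuous g) : ∫ x, c * (1 - (g x).re) ∂(uniformSphere A) =
      c * (1 - (∫ x, g x ∂(uniformSphere A)).re) := by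
  have := isProbabilityMeasure_uniformSphere (A := A)
  have hi := integrable_uniformSphere hg
  have h : ∫ x, (g x).re ∂(uniformSphere A) = (∫ x, g x ∂(uniformSphere A)).re :=
    integral_re hi
  have hi' : Integrable (fun x => (g x).re) (uniformSphere A) := hi.re
  rw [integral_const_mul, integral_sub (integrable_const _) hi', h]
  simp

lemma integral_sum_four [Nontrivial A]
    {g : Fin d → Fin d → Fin d → Fin d → Metric.sphere (0 : A) 1 → ℂ}
    (hg : ∀ i j k l, Continuous (g i j k l)) :
    ∫ x, ∑ i, ∑ j, ∑ k, ∑ l, g i j k l x ∂(uniformSphere A) =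
      ∑ i, ∑ j, ∑ k, ∑ l, ∫ x, g i j k l x ∂(uniformSphere A) := by
  rw [integral_finsetSum _ fun i _ => integrable_uniformSphere (by fun_prop)]
  refine Finset.sum_congr rfl fun i _ => ?_
  rw [integral_finsetSum _ fun i _ => integrable_uniformSphere (by fun_prop)]
  refine Finset.sum_congr rfl fun j _ => ?_
  rw [integral_finsetSum _ fun i _ => integrable_uniformSphere (by fun_prop)]
  refine Finset.sum_congr rfl fun k _ => ?_
  rw [integral_finsetSum _ fun i _ => integrable_uniformSphere (by fun_prop)]

omit [FiniteDimensional ℂ A] [MeasurableSpace A] [BorelSpace A] in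
lemma continuous_linearForm (e : OrthonormalBasis (Fin d) ℂ A) (p : Fin d → ℂ) :
    Continuous fun x : Metric.sphere (0 : A) 1 => ∑ i, p i * e.repr x i := by
  fun_prop

lemma integral_sum_linearForms [Nontrivial A] (e : OrthonormalBasis (Fin d) ℂ A)
    (p q r s : Fin d → Fin d → Fin d → ℂ) :
    ∫ x : Metric.sphere (0 : A) 1, ∑ j, ∑ j', (∑ i, p j j' i * e.repr x i) *
      conj (∑ i, q j j' i * e.repr x i) * (∑ i, r j j' i * e.repr x i) *
      conj (∑ i, s j j' i * e.repr x i) ∂(uniformSphere A) =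
    ∑ j, ∑ j', ((∑ i, p j j' i * conj (q j j' i)) * (∑ i, r j j' i * conj (s j j' i)) +
      (∑ i, p j j' i * conj (s j j' i)) * (∑ i, r j j' i * conj (q j j' i))) / (d * (d + 1)) := by
  have hc := continuous_linearForm (d := d) (A := A) e
  have hcc := fun p => Complex.continuous_conj.comp (hc p)
  have hcont : ∀ j j', Continuous fun x : Metric.sphere (0 : A) 1 =>
      (∑ i, p j j' i * e.repr x i) *
      conj (∑ i, q j j' i * e.repr x i) * (∑ i, r j j' i * e.repr x i) *
      conj (∑ i, s j j' i * e.repr x i) := fun j j' =>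
    (((hc _).mul (hcc _)).mul (hc _)).mul (hcc _)
  rw [integral_finsetSum _ fun i _ => integrable_uniformSphere
    (continuous_finsetSum _ fun j _ => hcont _ _)]
  refine Finset.sum_congr rfl fun j _ => ?_
  rw [integral_finsetSum _ fun i _ => integrable_uniformSphere (hcont _ _)]
  refine Finset.sum_congr rfl fun j' _ => ?_
  rw [integral_linearForms]

/-- The mean over the second factor of `x_p * conj x_q * x_r * conj x_s`, up to normalization. -/
noncomputable def partialMoment (e : OrthonormalBasis (Fin d) ℂ A) (p q r s : Fin d → Fin d → ℂ)
    (x : A) : ℂ :=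
  (∑ j, (∑ i, p i j * e.repr x i) * conj (∑ i, q i j * e.repr x i)) *
    (∑ j, (∑ i, r i j * e.repr x i) * conj (∑ i, s i j * e.repr x i)) +
  (∑ j, (∑ i, p i j * e.repr x i) * conj (∑ i, s i j * e.repr x i)) *
    (∑ j, (∑ i, r i j * e.repr x i) * conj (∑ i, q i j * e.repr x i))

omit [FiniteDimensional ℂ A] [MeasurableSpace A] [BorelSpace A] in
lemma continuous_partialMoment (e : OrthonormalBasis (Fin d) ℂ A) (p q r s : Fin d → Fin d → ℂ) :
    Continuous fun x : Metric.sphere (0 : A) 1 => partialMoment e p q r s x := by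
  have hc := continuous_linearForm (d := d) (A := A) e
  have hcc := fun p => Complex.continuous_conj.comp (hc p)
  have h : ∀ p q : Fin d → Fin d → ℂ, Continuous fun x : Metric.sphere (0 : A) 1 =>
      ∑ j, (∑ i, p i j * e.repr x i) * conj (∑ i, q i j * e.repr x i) := fun p q =>
    continuous_finsetSum _ fun j _ => (hc _).mul (hcc _)
  exact ((h p q).mul (h r s)).add ((h p s).mul (h r q))

/-- Each of the two pairings left by the second factor splits into two over the first, whence the
four terms of `productMoment`. -/
lemma integral_partialMoment [Nontrivial A] (e : OrthonormalBasis (Fin d) ℂ A)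
    (p q r s : Fin d → Fin d → ℂ) :
    ∫ x : Metric.sphere (0 : A) 1, partialMoment e p q r s x ∂(uniformSphere A) =
      productMoment p q r s / (d * (d + 1)) := by
  have hc := continuous_linearForm (d := d) (A := A) e
  have hcc := fun p => Complex.continuous_conj.comp (hc p)
  have hcont : ∀ p q r s : Fin d → Fin d → ℂ, Integrable (fun x : Metric.sphere (0 : A) 1 =>
      ∑ j, ∑ j', (∑ i, p i j * e.repr x i) * conj (∑ i, q i j * e.repr x i) *
        (∑ i, r i j' * e.repr x i) * conj (∑ i, s i j' * e.repr x i)) (uniformSphere A) := by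
    intro p q r s
    exact integrable_uniformSphere <| continuous_finsetSum _ fun j _ =>
      continuous_finsetSum _ fun j' _ => (((hc _).mul (hcc _)).mul (hc _)).mul (hcc _)
  simp only [partialMoment, Finset.sum_mul_sum, ← mul_assoc]
  rw [integral_add (hcont p q r s) (hcont p s r q),
    integral_sum_linearForms e (fun j _ i => p i j) (fun j _ i => q i j) (fun _ j' i => r i j')
      (fun _ j' i => s i j'),
    integral_sum_linearForms e (fun j _ i => p i j) (fun j _ i => s i j) (fun _ j' i => r i j')
      (fun _ j' i => q i j')]
  simp only [← Finset.sum_div, ← add_div, productMoment, Finset.sum_add_distrib]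
  simp only [Finset.sum_mul_sum (Finset.univ : Finset (Fin d)) Finset.univ
      (fun k => ∑ i, _) (fun k => ∑ i, _)]

omit [FiniteDimensional ℂ A] [MeasurableSpace A] [BorelSpace A] in
lemma nontrivial_of_orthonormalBasis (hd : 2 ≤ d) (e : OrthonormalBasis (Fin d) ℂ A) :
    Nontrivial A :=
  ⟨e ⟨0, by omega⟩, 0, e.orthonormal.ne_zero _⟩

/-- Each integration contributes a factor 1/(d(d+1)), so the mean purity is 2/(d+1) plus the defects
over d²(d+1)². -/
theorem entanglingPower_eq (hd : 2 ≤ d) (e : OrthonormalBasis (Fin d) ℂ A)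
    (f : OrthonormalBasis (Fin d) ℂ B) (U : A ⊗[ℂ] B ≃ₗᵢ[ℂ] A ⊗[ℂ] B) :
    entanglingPower U = d / (d + 1) - (gramDefect (tensorCoeff e f U) +
      gramDefect (swapOutput (tensorCoeff e f U))) / ((d - 1) * d * (d + 1) ^ 2) := by
  have := nontrivial_of_orthonormalBasis hd e
  have := nontrivial_of_orthonormalBasis hd f
  have hfin : Module.finrank ℂ A = d := by
    rw [Module.finrank_eq_card_basis e.toBasis, Fintype.card_fin]
  set u := tensorCoeff e f U with hu
  set c : ℝ := d / (d - 1) with hc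
  have hrow : RowOrthonormal u := sum_tensorCoeff_mul_conj e f U
  have hent : ∀ (a : A) (b : B), linearEntropy (U (a ⊗ₜ[ℂ] b)) = c * (1 -
      (∑ k, ∑ k', ∑ l, ∑ l', (∑ j, (∑ i, u k l i j * e.repr a i) * f.repr b j) *
        conj (∑ j, (∑ i, u k' l i j * e.repr a i) * f.repr b j) *
        (∑ j, (∑ i, u k' l' i j * e.repr a i) * f.repr b j) *
        conj (∑ j, (∑ i, u k l' i j * e.repr a i) * f.repr b j)).re) := by
    intro a b
    rw [linearEntropy, hfin, trace_reducedState_sq e f]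
    simp only [inner_tmul_isometry, ← hu, hc]
  have hinner : ∀ a : A, ∫ b : Metric.sphere (0 : B) 1, linearEntropy (U (a ⊗ₜ[ℂ] (b : B)))
      ∂(uniformSphere B) = c * (1 - (∑ k, ∑ k', ∑ l, ∑ l',
        partialMoment e (u k l) (u k' l) (u k' l') (u k l') a / (d * (d + 1))).re) := by
    intro a
    have hcf := continuous_linearForm (d := d) (A := B) f
    have hcc := fun p => Complex.continuous_conj.comp (hcf p)
    have hcont : ∀ p q r s : Fin d → Fin d → ℂ, Continuous fun b : Metric.sphere (0 : B) 1 =>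
        (∑ j, (∑ i, p i j * e.repr a i) * f.repr b j) *
        conj (∑ j, (∑ i, q i j * e.repr a i) * f.repr b j) *
        (∑ j, (∑ i, r i j * e.repr a i) * f.repr b j) *
        conj (∑ j, (∑ i, s i j * e.repr a i) * f.repr b j) := fun p q r s =>
      (((hcf _).mul (hcc _)).mul (hcf _)).mul (hcc _)
    simp only [hent]
    rw [integral_const_mul_one_sub_re c (continuous_finsetSum _ fun k _ =>
      continuous_finsetSum _ fun k' _ => continuous_finsetSum _ fun l _ =>
      continuous_finsetSum _ fun l' _ => hcont (u k l) (u k' l) (u k' l') (u k l')),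
      integral_sum_four fun k k' l l' => hcont (u k l) (u k' l) (u k' l') (u k l')]
    simp only [integral_linearForms, partialMoment]
  have hcont : ∀ p q r s : Fin d → Fin d → ℂ, Continuous fun a : Metric.sphere (0 : A) 1 =>
      partialMoment e p q r s a / (d * (d + 1) : ℂ) := fun p q r s =>
    (continuous_partialMoment e p q r s).div_const _
  rw [entanglingPower]
  simp only [hinner]
  rw [integral_const_mul_one_sub_re c (continuous_finsetSum _ fun k _ =>
      continuous_finsetSum _ fun k' _ => continuous_finsetSum _ fun l _ =>
      continuous_finsetSum _ fun l' _ => hcont (u k l) (u k' l) (u k' l') (u k l')),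
      integral_sum_four fun k k' l l' => hcont (u k l) (u k' l) (u k' l') (u k l')]
  simp only [integral_div, integral_partialMoment, ← Finset.sum_div]
  rw [hrow.sum_productMoment]
  have hD : (d * (d + 1) : ℂ) = ((d * (d + 1) : ℝ) : ℂ) := by push_cast; rfl
  rw [hD, ← Complex.ofReal_div, ← Complex.ofReal_div, Complex.ofReal_re, hc]
  have h2 : (2 : ℝ) ≤ d := by exact_mod_cast hd
  have h3 : (d : ℝ) - 1 ≠ 0 := by linarith
  have h4 : (d : ℝ) ≠ 0 := by linarith
  have h5 : (d : ℝ) + 1 ≠ 0 := by linarith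
  field_simp
  ring

end EntanglingPower

/-! ### Permutation operators and orthogonal latin squares. -/

section Permutation

open scoped ComplexConjugate

variable {d : ℕ}

/-- Diagonal entries equal to 1 make each column of `L` a permutation; vanishing entries with j ≠ j'
forbid repetitions in the rows of `K`. -/
lemma sum_coincidence_eq_iff (K L : Matrix (Fin d) (Fin d) (Fin d)) :
    (∀ l j l' j', (∑ i, if K i j = K i j' ∧ l = L i j ∧ l' = L i j' then (1 : ℂ) else 0) =
      (if l = l' then 1 else 0) * (if j = j' then 1 else 0)) ↔
    (∀ j, Function.Bijective fun i => L i j) ∧ (∀ i, Function.Bijective fun j => K i j) := by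
  simp only [← Finite.injective_iff_bijective (f := fun j => K _ j)]
  simp only [Finset.sum_boole]
  constructor
  · intro h
    refine ⟨fun j => Finite.surjective_iff_bijective.1 fun l => ?_, fun i j j' hK => ?_⟩
    · by_contra! hn
      have := h l j l j
      simp [fun i => (hn i).symm] at this
    · by_contra hj
      -- The index `i` is itself counted in this off-diagonal entry, which should be zero.
      have := h (L i j) j (L i j') j'
      rw [if_neg hj, mul_zero, Nat.cast_eq_zero, Finset.card_eq_zero] at this
      exact Finset.notMem_empty i (this ▸ Finset.mem_filter.2 ⟨Finset.mem_univ _, hK, rfl, rfl⟩)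
  · rintro ⟨hL, hK⟩ l j l' j'
    by_cases hj : j = j'
    · subst hj
      by_cases hl : l = l'
      · subst hl
        obtain ⟨i, hi, hu⟩ := (hL j).existsUnique l
        have : (Finset.univ.filter fun i => K i j = K i j ∧ l = L i j ∧ l = L i j) = {i} := by
          ext i'
          simp only [Finset.mem_filter, Finset.mem_univ, true_and, and_self, Finset.mem_singleton]
          exact ⟨fun h => hu i' h.symm, fun h => h ▸ hi.symm⟩
        rw [this]
        simp
      · rw [if_neg hl, zero_mul, Nat.cast_eq_zero, Finset.card_eq_zero,
          Finset.filter_eq_empty_iff]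
        rintro i - ⟨-, h1, h2⟩
        exact hl (h1.trans h2.symm)
    · rw [if_neg hj, mul_zero, Nat.cast_eq_zero, Finset.card_eq_zero, Finset.filter_eq_empty_iff]
      rintro i - ⟨h, -⟩
      exact hj (hK i h)

/-- The coefficients of the permutation operator given by `K` and `L`. -/
def permCoeff (K L : Matrix (Fin d) (Fin d) (Fin d)) (k l i j : Fin d) : ℂ :=
  if k = K i j ∧ l = L i j then 1 else 0

lemma gramRight_permCoeff (K L : Matrix (Fin d) (Fin d) (Fin d)) (l j l' j' : Fin d) :
    gramRight (permCoeff K L) l j l' j' =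
      ∑ i, if K i j = K i j' ∧ l = L i j ∧ l' = L i j' then (1 : ℂ) else 0 := by
  rw [gramRight, Finset.sum_comm]
  refine Finset.sum_congr rfl fun i _ => ?_
  rw [Finset.sum_eq_single (K i j)]
  · by_cases a : K i j = K i j' <;> by_cases b : l = L i j <;> by_cases c : l' = L i j' <;>
      simp [permCoeff, a, b, c]
  · intro k _ hk
    simp [permCoeff, hk]
  · simp

/-- One combinatorial criterion thus serves both Gram matrices, with `K` and `L` exchanged. -/
lemma swapOutput_permCoeff (K L : Matrix (Fin d) (Fin d) (Fin d)) :
    swapOutput (permCoeff K L) = permCoeff L K := by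
  funext k l i j
  simp only [swapOutput, permCoeff, and_comm]

variable {A B : Type*} [NormedAddCommGroup A] [InnerProductSpace ℂ A]
    [NormedAddCommGroup B] [InnerProductSpace ℂ B]
    {e : OrthonormalBasis (Fin d) ℂ A} {f : OrthonormalBasis (Fin d) ℂ B}

lemma tmul_orthonormalBasis_inj (e : OrthonormalBasis (Fin d) ℂ A)
    (f : OrthonormalBasis (Fin d) ℂ B) {k k' l l' : Fin d}
    (h : e k ⊗ₜ[ℂ] f l = e k' ⊗ₜ[ℂ] f l') : k = k' ∧ l = l' := by
  have := (e.tensorProduct f).toBasis.injective (a₁ := (k, l)) (a₂ := (k', l'))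
    (by simpa [OrthonormalBasis.tensorProduct_apply] using h)
  simpa using this

lemma IsPermutationOperator.tensorCoeff_eq {P : A ⊗[ℂ] B ≃ₗᵢ[ℂ] A ⊗[ℂ] B}
    {K L : Matrix (Fin d) (Fin d) (Fin d)} (h : IsPermutationOperator e f P K L) :
    tensorCoeff e f P = permCoeff K L := by
  funext k l i j
  rw [tensorCoeff, h, TensorProduct.inner_tmul, orthonormal_iff_ite.1 e.orthonormal,
    orthonormal_iff_ite.1 f.orthonormal, permCoeff, ite_and]
  split_ifs <;> simp

lemma IsPermutationOperator.bijective {P : A ⊗[ℂ] B ≃ₗᵢ[ℂ] A ⊗[ℂ] B}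
    {K L : Matrix (Fin d) (Fin d) (Fin d)} (h : IsPermutationOperator e f P K L) :
    Function.Bijective fun p : Fin d × Fin d => (K p.1 p.2, L p.1 p.2) := by
  rw [← Finite.injective_iff_bijective]
  rintro ⟨i, j⟩ ⟨i', j'⟩ hp
  simp only [Prod.mk.injEq] at hp
  have := h i j
  rw [hp.1, hp.2, ← h i' j'] at this
  obtain ⟨rfl, rfl⟩ := tmul_orthonormalBasis_inj e f (P.injective this)
  rfl

lemma IsPermutationOperator.matrix_unique {P : A ⊗[ℂ] B ≃ₗᵢ[ℂ] A ⊗[ℂ] B}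
    {K L K' L' : Matrix (Fin d) (Fin d) (Fin d)} (h : IsPermutationOperator e f P K L)
    (h' : IsPermutationOperator e f P K' L') : K = K' ∧ L = L' := by
  have := fun i j => tmul_orthonormalBasis_inj e f ((h i j).symm.trans (h' i j))
  exact ⟨funext fun i => funext fun j => (this i j).1, funext fun i => funext fun j => (this i j).2⟩

lemma IsPermutationOperator.unique {P P' : A ⊗[ℂ] B ≃ₗᵢ[ℂ] A ⊗[ℂ] B}
    {K L : Matrix (Fin d) (Fin d) (Fin d)} (h : IsPermutationOperator e f P K L)
    (h' : IsPermutationOperator e f P' K L) : P = P' := by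
  have := (e.tensorProduct f).toBasis.ext (f₁ := P.toLinearEquiv.toLinearMap)
    (f₂ := P'.toLinearEquiv.toLinearMap) fun ⟨i, j⟩ => by
      simpa [OrthonormalBasis.tensorProduct_apply] using (h i j).trans (h' i j).symm
  exact LinearIsometryEquiv.ext fun x => LinearMap.congr_fun this x

lemma exists_isPermutationOperator (e : OrthonormalBasis (Fin d) ℂ A)
    (f : OrthonormalBasis (Fin d) ℂ B) {K L : Matrix (Fin d) (Fin d) (Fin d)}
    (h : Function.Bijective fun p : Fin d × Fin d => (K p.1 p.2, L p.1 p.2)) :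
    ∃ P : A ⊗[ℂ] B ≃ₗᵢ[ℂ] A ⊗[ℂ] B, IsPermutationOperator e f P K L := by
  refine ⟨(e.tensorProduct f).equiv (e.tensorProduct f) (Equiv.ofBijective _ h), fun i j => ?_⟩
  have := (e.tensorProduct f).equiv_apply_basis (e.tensorProduct f) (Equiv.ofBijective _ h) (i, j)
  simpa [OrthonormalBasis.tensorProduct_apply] using this

lemma IsOrthogonalLatinPair.symm {K L : Matrix (Fin d) (Fin d) (Fin d)}
    (h : IsOrthogonalLatinPair K L) : IsOrthogonalLatinPair L K :=
  ⟨h.2.1, h.1, (Equiv.prodComm _ _).bijective.comp h.2.2⟩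

/-- If the squares coincided, only diagonal pairs of symbols would occur, and (0, 1) would be
missed. -/
lemma IsOrthogonalLatinPair.ne (hd : 2 ≤ d) {K L : Matrix (Fin d) (Fin d) (Fin d)}
    (h : IsOrthogonalLatinPair K L) : K ≠ L := by
  rintro rfl
  obtain ⟨p, hp⟩ := h.2.2.surjective (⟨0, by omega⟩, ⟨1, by omega⟩)
  simp only [Prod.mk.injEq] at hp
  simpa using congrArg Fin.val (hp.1.symm.trans hp.2)

variable [FiniteDimensional ℂ A] [MeasurableSpace A] [BorelSpace A]
    [FiniteDimensional ℂ B] [MeasurableSpace B] [BorelSpace B]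

lemma entanglingPower_le (hd : 2 ≤ d) (e : OrthonormalBasis (Fin d) ℂ A)
    (f : OrthonormalBasis (Fin d) ℂ B) (U : A ⊗[ℂ] B ≃ₗᵢ[ℂ] A ⊗[ℂ] B) :
    entanglingPower U ≤ (d : ℝ) / (d + 1) := by
  rw [entanglingPower_eq hd e f]
  have h2 : (2 : ℝ) ≤ d := by exact_mod_cast hd
  have h3 : (0 : ℝ) ≤ d - 1 := by linarith
  have hD : 0 ≤ ((d : ℝ) - 1) * d * (d + 1) ^ 2 := by positivity
  exact sub_le_self _ (div_nonneg (add_nonneg (gramDefect_nonneg _) (gramDefect_nonneg _)) hD)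

lemma entanglingPower_eq_max_iff (hd : 2 ≤ d) (e : OrthonormalBasis (Fin d) ℂ A)
    (f : OrthonormalBasis (Fin d) ℂ B) (U : A ⊗[ℂ] B ≃ₗᵢ[ℂ] A ⊗[ℂ] B) :
    entanglingPower U = (d : ℝ) / (d + 1) ↔ gramDefect (tensorCoeff e f U) = 0 ∧
      gramDefect (swapOutput (tensorCoeff e f U)) = 0 := by
  have h2 : (2 : ℝ) ≤ d := by exact_mod_cast hd
  have h3 : (0 : ℝ) < d - 1 := by linarith
  have hD : ((d : ℝ) - 1) * d * (d + 1) ^ 2 ≠ 0 := by positivity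
  rw [entanglingPower_eq hd e f, sub_eq_self, div_eq_zero_iff, or_iff_left hD,
    add_eq_zero_iff_of_nonneg (gramDefect_nonneg _) (gramDefect_nonneg _)]

lemma IsPermutationOperator.entanglingPower_eq_max_iff (hd : 2 ≤ d)
    {P : A ⊗[ℂ] B ≃ₗᵢ[ℂ] A ⊗[ℂ] B} {K L : Matrix (Fin d) (Fin d) (Fin d)}
    (h : IsPermutationOperator e f P K L) :
    entanglingPower P = (d : ℝ) / (d + 1) ↔ IsOrthogonalLatinPair K L := by
  rw [_root_.entanglingPower_eq_max_iff hd e f, h.tensorCoeff_eq, swapOutput_permCoeff,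
    gramDefect_eq_zero_iff, gramDefect_eq_zero_iff]
  simp only [gramRight_permCoeff, sum_coincidence_eq_iff]
  -- One Gram matrix controls the columns of `L` and the rows of `K`, the other the columns of `K`
  -- and the rows of `L`; orthogonality comes from `P` itself.
  exact ⟨fun ⟨⟨h1, h2⟩, h3, h4⟩ => ⟨⟨h2, h3⟩, ⟨h4, h1⟩, h.bijective⟩,
    fun ⟨⟨h2, h3⟩, ⟨h4, h1⟩, _⟩ => ⟨⟨h1, h2⟩, h3, h4⟩⟩

lemma exists_equiv_orthogonalLatinPair (hd : 2 ≤ d) (e : OrthonormalBasis (Fin d) ℂ A)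
    (f : OrthonormalBasis (Fin d) ℂ B) :
    ∃ Φ : {P : A ⊗[ℂ] B ≃ₗᵢ[ℂ] A ⊗[ℂ] B //
          (∃ K L, IsPermutationOperator e f P K L) ∧
            entanglingPower P = (d : ℝ) / (d + 1)} ≃
        {KL : Matrix (Fin d) (Fin d) (Fin d) × Matrix (Fin d) (Fin d) (Fin d) //
          IsOrthogonalLatinPair KL.1 KL.2},
      ∀ P, IsPermutationOperator e f P.1 (Φ P).1.1 (Φ P).1.2 := by
  choose K L hKL using fun P : {P : A ⊗[ℂ] B ≃ₗᵢ[ℂ] A ⊗[ℂ] B //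
      (∃ K L, IsPermutationOperator e f P K L) ∧ entanglingPower P = (d : ℝ) / (d + 1)} => P.2.1
  refine ⟨Equiv.ofBijective
    (fun P => ⟨(K P, L P), ((hKL P).entanglingPower_eq_max_iff hd).1 P.2.2⟩) ⟨?_, ?_⟩, hKL⟩
  · intro P Q h
    simp only [Subtype.mk.injEq, Prod.mk.injEq] at h
    have hP := hKL P
    rw [h.1, h.2] at hP
    exact Subtype.ext (hP.unique (hKL Q))
  · rintro ⟨⟨K', L'⟩, h⟩
    obtain ⟨P, hP⟩ := exists_isPermutationOperator e f h.2.2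
    let Q : {P : A ⊗[ℂ] B ≃ₗᵢ[ℂ] A ⊗[ℂ] B // (∃ K L, IsPermutationOperator e f P K L) ∧
        entanglingPower P = (d : ℝ) / (d + 1)} :=
      ⟨P, ⟨K', L', hP⟩, (hP.entanglingPower_eq_max_iff hd).2 h⟩
    refine ⟨Q, Subtype.ext ?_⟩
    -- The arrays picked by `choose` for `Q` must be the given ones, since an operator determines
    -- its arrays.
    obtain ⟨h1, h2⟩ := (hKL Q).matrix_unique hP
    exact Prod.ext h1 h2

lemma ncard_permutationOperator_unordered (hd : 2 ≤ d) (e : OrthonormalBasis (Fin d) ℂ A)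
    (f : OrthonormalBasis (Fin d) ℂ B) {K L : Matrix (Fin d) (Fin d) (Fin d)}
    (h : IsOrthogonalLatinPair K L) :
    {P : A ⊗[ℂ] B ≃ₗᵢ[ℂ] A ⊗[ℂ] B | entanglingPower P = (d : ℝ) / (d + 1) ∧
      (IsPermutationOperator e f P K L ∨ IsPermutationOperator e f P L K)}.ncard = 2 := by
  obtain ⟨P, hP⟩ := exists_isPermutationOperator e f h.2.2
  obtain ⟨Q, hQ⟩ := exists_isPermutationOperator e f h.symm.2.2
  refine Set.ncard_eq_two.2 ⟨P, Q, ?_, ?_⟩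
  · rintro rfl
    exact h.ne hd (hP.matrix_unique hQ).1
  · ext R
    simp only [Set.mem_ofPred_eq, Set.mem_insert_iff, Set.mem_singleton_iff]
    constructor
    · rintro ⟨-, hR | hR⟩
      · exact Or.inl (hR.unique hP)
      · exact Or.inr (hR.unique hQ)
    · rintro (rfl | rfl)
      · exact ⟨(hP.entanglingPower_eq_max_iff hd).2 h, Or.inl hP⟩
      · exact ⟨(hQ.entanglingPower_eq_max_iff hd).2 h.symm, Or.inr hQ⟩

end Permutation

theorem theorem4 {A B : Type*}
    [NormedAddCommGroup A] [InnerProductSpace ℂ A] [FiniteDimensional ℂ A]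
    [MeasurableSpace A] [BorelSpace A]
    [NormedAddCommGroup B] [InnerProductSpace ℂ B] [FiniteDimensional ℂ B]
    [MeasurableSpace B] [BorelSpace B]
    (d : ℕ) (hd : 2 ≤ d)
    (e : OrthonormalBasis (Fin d) ℂ A) (f : OrthonormalBasis (Fin d) ℂ B) :
    -- `d / (d + 1)` bounds the entangling power of every unitary, so a unitary
    -- with this value is a maximizer
    (∀ U : A ⊗[ℂ] B ≃ₗᵢ[ℂ] A ⊗[ℂ] B, entanglingPower U ≤ (d : ℝ) / (d + 1)) ∧
    -- the criterion for permutation operators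
    (∀ (P : A ⊗[ℂ] B ≃ₗᵢ[ℂ] A ⊗[ℂ] B) (K L : Matrix (Fin d) (Fin d) (Fin d)),
      IsPermutationOperator e f P K L →
        (entanglingPower P = (d : ℝ) / (d + 1) ↔ IsOrthogonalLatinPair K L)) ∧
    -- the bijection with ordered pairs
    (∃ Φ : {P : A ⊗[ℂ] B ≃ₗᵢ[ℂ] A ⊗[ℂ] B //
          (∃ K L, IsPermutationOperator e f P K L) ∧
            entanglingPower P = (d : ℝ) / (d + 1)} ≃
        {KL : Matrix (Fin d) (Fin d) (Fin d) × Matrix (Fin d) (Fin d) (Fin d) //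
          IsOrthogonalLatinPair KL.1 KL.2},
      ∀ P, IsPermutationOperator e f P.1 (Φ P).1.1 (Φ P).1.2) ∧
    -- every unordered pair comes from exactly two permutation operators
    (∀ K L : Matrix (Fin d) (Fin d) (Fin d), IsOrthogonalLatinPair K L →
      {P : A ⊗[ℂ] B ≃ₗᵢ[ℂ] A ⊗[ℂ] B | entanglingPower P = (d : ℝ) / (d + 1) ∧
        (IsPermutationOperator e f P K L ∨ IsPermutationOperator e f P L K)}.ncard = 2) :=
  ⟨entanglingPower_le hd e f, fun _ _ _ h => h.entanglingPower_eq_max_iff hd,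
    exists_equiv_orthogonalLatinPair hd e f,
    fun _ _ h => ncard_permutationOperator_unordered hd e f h⟩
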